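/- Let $G$ be an $\omega$-categorical group, i.e. a group such that any two countably infinite models of its complete first-order theory (in the language of groups) are isomorphic. Let $H\le G$ be a residually finite subgroup that is inert in $G$, i.e. $H\cap gHg^{-1}$ has finite index in $H$ for every $g\in G$. Let $X$ be the set of all left cosets $gK$, where $g\in G$ and $K\le G$ is commensurable with $H$ (i.e. $H\cap K$ has finite index in both $H$ and $K$), let $G$ act on $X$ by left multiplication, and let $\overline{G}$ (the completion of $G$ with respect to $H$) be the closure in $\mathrm{Sym}(X)$, with the topology of pointwise convergence ($X$ discrete), of the permutation group induced by $G$ on $X$. Then: 1. every finitely generated subgroup of $\overline{G}$ is a homomorphic image of some finite subgroup of $G$; 2. $\overline{G}$ is locally finite, i.e. every finitely generated subgroup of $\overline{G}$ is finite; 3. for every $k\ge 0$, if $G$ is nilpotent of class $k$, then $\overline{G}$ is nilpotent of class $k$; 4. for every $k\ge 0$, if $G$ is soluble of derived length $k$, then $\overline{G}$ is soluble of derived length $k$. -/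

import Mathlib

open scoped Pointwise

namespace OmegaCatGroup

/-- The function symbols of the language of groups: multiplication, inverse and identity. -/
inductive GroupFunc : ℕ → Type
  | mul : GroupFunc 2
  | inv : GroupFunc 1
  | one : GroupFunc 0

/-- The first-order language of groups. -/
def groupLanguage : FirstOrder.Language.{0, 0} where
  Functions := GroupFunc
  Relations := fun _ => Empty

/-- A group as a first-order structure in the language of groups. -/
instance groupStructure (G : Type*) [Group G] : groupLanguage.Structure G where
  funMap {_} f :=
    match f with
    | .mul => fun x => x 0 * x 1
    | .inv => fun x => (x 0)⁻¹
    | .one => fun _ => 1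
  RelMap {_} r := nomatch r

/-- A group is `ω`-categorical if any two countably infinite models of its complete first-order
theory are isomorphic. -/
def IsOmegaCategorical.{u} (G : Type u) [Group G] : Prop :=
  Cardinal.aleph0.{u}.Categorical (groupLanguage.completeTheory G)

/-- `H` is inert in `G` if `H ∩ gHg⁻¹` has finite index in `H` for every `g ∈ G`. -/
def IsInert {G : Type*} [Group G] (H : Subgroup G) : Prop :=
  ∀ g : G, ((H ⊓ MulAut.conj g • H).subgroupOf H).FiniteIndex

/-- The set `X` of all left cosets `gK` (as subsets of `G`) of the subgroups `K` commensurable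
with `H`, with the action of `G` by left multiplication. -/
def cosetSpace {G : Type*} [Group G] (H : Subgroup G) : SubMulAction G (Set G) where
  carrier := {S | ∃ K : Subgroup G, K.Commensurable H ∧ ∃ g : G, S = g • (K : Set G)}
  smul_mem' := by
    rintro c _ ⟨K, hK, g, rfl⟩
    exact ⟨K, hK, c * g, (mul_smul c g (K : Set G)).symm⟩

/-- The topology of pointwise convergence on `Sym(X)`, where `X` is discrete. -/
instance permTopology (X : Type*) : TopologicalSpace (Equiv.Perm X) :=
  TopologicalSpace.induced (fun σ => (σ : X → X)) (@Pi.topologicalSpace X (fun _ => X) fun _ => ⊥)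

theorem continuous_perm_iff {X Y : Type*} [TopologicalSpace Y] {f : Y → Equiv.Perm X} :
    Continuous f ↔ ∀ x y : X, IsOpen {t | f t x = y} := by
  let _ : TopologicalSpace X := ⊥
  have : DiscreteTopology X := ⟨rfl⟩
  rw [continuous_induced_rng, continuous_pi_iff]
  exact forall_congr' fun x => continuous_discrete_rng

theorem isOpen_perm_apply_eq {X : Type*} (x y : X) : IsOpen {σ : Equiv.Perm X | σ x = y} :=
  continuous_perm_iff.1 continuous_id x y

instance permTopologicalGroup (X : Type*) : IsTopologicalGroup (Equiv.Perm X) where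
  continuous_mul := by
    rw [continuous_perm_iff]
    intro x y
    have h : {t : Equiv.Perm X × Equiv.Perm X | (t.1 * t.2) x = y} =
        ⋃ z : X, {σ : Equiv.Perm X | σ z = y} ×ˢ {σ : Equiv.Perm X | σ x = z} := by
      ext t
      simp
    rw [h]
    exact isOpen_iUnion fun z => (isOpen_perm_apply_eq z y).prod (isOpen_perm_apply_eq x z)
  continuous_inv := by
    rw [continuous_perm_iff]
    intro x y
    have h : {t : Equiv.Perm X | t⁻¹ x = y} = {σ : Equiv.Perm X | σ y = x} := by
      ext t
      simp only [Set.mem_ofPred_eq, Equiv.Perm.inv_eq_iff_eq]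
      exact eq_comm
    rw [h]
    exact isOpen_perm_apply_eq y x

/-- The completion of `G` with respect to `H`: the closure, in `Sym(X)`, of the permutation group
induced by `G` on the space `X` of cosets of the subgroups commensurable with `H`. -/
def completion {G : Type*} [Group G] (H : Subgroup G) : Subgroup (Equiv.Perm (cosetSpace H)) :=
  (MulAction.toPermHom G (cosetSpace H)).range.topologicalClosure

/-- `G` is nilpotent of class exactly `k`. -/
def HasNilpotencyClass (G : Type*) [Group G] (k : ℕ) : Prop :=
  Group.IsNilpotent G ∧ Group.nilpotencyClass G = k

/-- `G` is soluble of derived length exactly `k`. -/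
def HasDerivedLength (G : Type*) [Group G] (k : ℕ) : Prop :=
  IsLeast {n | derivedSeries G n = ⊥} k

end OmegaCatGroup

/-! By Ryll-Nardzewski, `G` has finitely many `n`-types, and the type of a tuple determines the
relations it satisfies. So only finitely many kernels of maps from the free group on `n` letters to
`G` occur (`finite_range_ker_lift`), which also makes finitely generated subgroups of `G` finite. A
tuple in the completion is a limit of images of tuples of `G`. Finitely many kernels means that
tuples with one fixed kernel already converge to it, and a relation is a closed condition, so the
limit satisfies all relations of some tuple of `G` (`exists_ker_lift_le_of_mem_closure`). Its span
is therefore a quotient of a finite subgroup of `G`.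

For nilpotency and solubility, residual finiteness of `H` embeds `G` in its completion, and
continuity of commutators carries the vanishing of either series to the closure. -/

namespace OmegaCatGroup

/-! ### Omitting types and the type-counting half of Ryll-Nardzewski. -/

section ModelTheory

open FirstOrder FirstOrder.Language Set Filter Cardinal

universe u v w

variable {L : FirstOrder.Language.{u, v}} {M : Type w} [L.Structure M]

/-- The Tarski–Vaught test for a subset that is not known to be a substructure. -/
theorem exists_elementarySubstructure_eq (S : Set M)
    (h : ∀ (n : ℕ) (φ : L.Formula (Fin (n + 1))) (x : Fin n → M), (∀ i, x i ∈ S) → ∀ a : M,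
      φ.Realize (Fin.snoc x a : _ → M) → ∃ b ∈ S, φ.Realize (Fin.snoc x b : _ → M)) :
    ∃ N : L.ElementarySubstructure M, (N : Set M) = S := by
  let N : L.Substructure M :=
    { carrier := S
      fun_mem := by
        intro n f x hx
        obtain ⟨b, hb, hf⟩ := h n
          ((Term.func f fun l => Term.var l.castSucc).equal (Term.var (Fin.last n))) x hx
          (Structure.funMap f x) (by simp)
        have : Structure.funMap f x = b := by simpa using hf
        rwa [this] }
  refine ⟨N.toElementarySubstructure fun n φ x a hφ => ?_, rfl⟩
  have key (b : M) : (φ.toFormula.relabel (Sum.elim Empty.elim id)).Realize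
      (Fin.snoc ((↑) ∘ x) b : _ → M) ↔ φ.Realize default (Fin.snoc ((↑) ∘ x) b : _ → M) := by
    rw [Formula.realize_relabel, BoundedFormula.realize_toFormula]
    exact iff_of_eq (congrArg₂ _ (Subsingleton.elim _ _) rfl)
  obtain ⟨b, hb, hφb⟩ := h n (φ.toFormula.relabel (Sum.elim Empty.elim id)) (Subtype.val ∘ x)
    (fun i => by exact (x i).2) a ((key a).2 hφ)
  exact ⟨⟨b, hb⟩, (key b).1 hφb⟩

variable (L) in
/-- A set of sequences that is defined by a formula in finitely many of the coordinates. -/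
def IsDefinableCylinder (D : Set (ℕ → M)) : Prop :=
  ∃ (m : ℕ) (E : Set (Fin m → M)), (∅ : Set M).Definable L E ∧ D = {v | (fun i : Fin m => v i) ∈ E}

theorem IsDefinableCylinder.exists_ge {D : Set (ℕ → M)} (hD : IsDefinableCylinder L D) (k : ℕ) :
    ∃ m ≥ k, ∃ E : Set (Fin m → M),
      (∅ : Set M).Definable L E ∧ D = {v | (fun i : Fin m => v i) ∈ E} := by
  obtain ⟨m, E, hE, rfl⟩ := hD
  exact ⟨max m k, le_max_right _ _, _, hE.preimage_comp (Fin.castLE (le_max_left m k)), rfl⟩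

theorem IsDefinableCylinder.inter {D₁ D₂ : Set (ℕ → M)} (h₁ : IsDefinableCylinder L D₁)
    (h₂ : IsDefinableCylinder L D₂) : IsDefinableCylinder L (D₁ ∩ D₂) := by
  obtain ⟨m, E₁, hE₁, rfl⟩ := h₁
  obtain ⟨k, hk, E₂, hE₂, rfl⟩ := h₂.exists_ge m
  exact ⟨k, _, (hE₁.preimage_comp (Fin.castLE hk)).inter hE₂, rfl⟩

theorem isDefinableCylinder_realize {n : ℕ} (φ : L.Formula (Fin n)) (i : Fin n → ℕ) :
    IsDefinableCylinder L {v : ℕ → M | φ.Realize (v ∘ i)} := by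
  have hi (l : Fin n) : i l < Finset.univ.sup i + 1 :=
    Nat.lt_succ_of_le (Finset.le_sup (Finset.mem_univ l))
  exact ⟨_, _, (empty_definable_iff.2 ⟨φ, rfl⟩ : (∅ : Set M).Definable L _).preimage_comp
    (fun l => (⟨i l, hi l⟩ : Fin _)), rfl⟩

/-- Projections of definable sets are definable, by existential quantification. -/
theorem IsDefinableCylinder.exists_formula_image [Nonempty M] {D : Set (ℕ → M)}
    (hD : IsDefinableCylinder L D) {n : ℕ} (i : Fin n → ℕ) :
    ∃ ψ : L.Formula (Fin n), ∀ b : Fin n → M, ψ.Realize b ↔ ∃ v ∈ D, v ∘ i = b := by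
  obtain ⟨m, hm, E, hE, rfl⟩ := hD.exists_ge (Finset.univ.sup i + 1)
  have hi (l : Fin n) : i l < m :=
    (Nat.lt_succ_of_le (Finset.le_sup (Finset.mem_univ l))).trans_le hm
  obtain ⟨ψ, hψ⟩ := empty_definable_iff.1 (hE.image_comp fun l => (⟨i l, hi l⟩ : Fin m))
  refine ⟨ψ, fun b => ?_⟩
  have hb : b ∈ Set.ofPred ψ.Realize ↔ ∃ v ∈ {v : ℕ → M | (fun i : Fin m => v i) ∈ E}, v ∘ i = b := by
    rw [← hψ]
    constructor
    · rintro ⟨e, he, rfl⟩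
      -- The cylinder does not constrain coordinates from `m` on, so any value will do there.
      refine ⟨fun k => if hk : k < m then e ⟨k, hk⟩ else Classical.arbitrary M, ?_, ?_⟩
      · simpa using he
      · ext l
        simp [hi l]
    · rintro ⟨v, hv, rfl⟩
      exact ⟨_, hv, rfl⟩
  exact hb

/-- A nonempty definable cylinder can be shrunk so that it either supplies a witness for `φ` at one
of the coordinates, or excludes all witnesses. -/
theorem IsDefinableCylinder.exists_subset_witness {D : Set (ℕ → M)} (hD : IsDefinableCylinder L D)
    (hne : D.Nonempty) {n : ℕ} (φ : L.Formula (Fin (n + 1))) (i : Fin n → ℕ) :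
    ∃ D' ⊆ D, IsDefinableCylinder L D' ∧ D'.Nonempty ∧
      ((∃ j, ∀ v ∈ D', φ.Realize (Fin.snoc (v ∘ i) (v j) : _ → M)) ∨
        ∀ v ∈ D', ∀ a, ¬ φ.Realize (Fin.snoc (v ∘ i) a : _ → M)) := by
  by_cases h : ∃ v ∈ D, ∃ a, φ.Realize (Fin.snoc (v ∘ i) a : _ → M)
  · obtain ⟨v, hv, a, ha⟩ := h
    obtain ⟨m, hm, E, hE, hDE⟩ := hD.exists_ge (Finset.univ.sup i + 1)
    have hi (l : Fin n) : i l < m :=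
      (Nat.lt_succ_of_le (Finset.le_sup (Finset.mem_univ l))).trans_le hm
    have hsnoc (w : ℕ → M) : w ∘ (Fin.snoc i m : Fin (n + 1) → ℕ) = Fin.snoc (w ∘ i) (w m) := by
      ext l
      cases l using Fin.lastCases <;> simp
    -- The coordinate `m` is fresh: neither `D` nor `i` refers to it, so it can be overwritten with
    -- the witness `a`.
    refine ⟨D ∩ {w | φ.Realize (w ∘ (Fin.snoc i m : Fin (n + 1) → ℕ))}, inter_subset_left,
      hD.inter (isDefinableCylinder_realize _ _), ⟨Function.update v m a, ?_, ?_⟩,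
      .inl ⟨m, fun w hw => ?_⟩⟩
    · rw [hDE] at hv ⊢
      have : (fun i : Fin m => Function.update v m a i) = fun i : Fin m => v i := by
        ext l
        exact Function.update_of_ne l.2.ne _ _
      rwa [mem_ofPred_eq, this]
    · rw [mem_ofPred_eq, hsnoc]
      have : Function.update v m a ∘ i = v ∘ i := by
        ext l
        exact Function.update_of_ne (hi l).ne _ _
      rwa [this, Function.update_self]
    · rw [← hsnoc]
      exact hw.2
  · push Not at h
    exact ⟨D, Subset.rfl, hD, hne, .inr h⟩

/-- The projection of `D` to the coordinates `i` is defined by a consistent formula, which by `hp`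
cannot isolate `p`. Some `χ ∈ p` thus fails at a point of the projection, and adding `¬χ` keeps the
cylinder nonempty. -/
theorem IsDefinableCylinder.exists_subset_omitting [Nonempty M] {D : Set (ℕ → M)}
    (hD : IsDefinableCylinder L D) (hne : D.Nonempty) {n : ℕ} {p : Set (L.Formula (Fin n))}
    (hp : ∀ ψ : L.Formula (Fin n), (∃ b : Fin n → M, ψ.Realize b) →
      ∃ b : Fin n → M, ψ.Realize b ∧ ∃ χ ∈ p, ¬ χ.Realize b) (i : Fin n → ℕ) :
    ∃ D' ⊆ D, IsDefinableCylinder L D' ∧ D'.Nonempty ∧ ∃ χ ∈ p, ∀ v ∈ D', ¬ χ.Realize (v ∘ i) := by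
  obtain ⟨ψ, hψ⟩ := hD.exists_formula_image i
  obtain ⟨v, hv⟩ := hne
  obtain ⟨b, hb, χ, hχ, hχb⟩ := hp ψ ⟨v ∘ i, (hψ _).2 ⟨v, hv, rfl⟩⟩
  obtain ⟨w, hw, rfl⟩ := (hψ b).1 hb
  refine ⟨D ∩ {w | χ.not.Realize (w ∘ i)}, inter_subset_left,
    hD.inter (isDefinableCylinder_realize _ _), ⟨w, hw, by simpa using hχb⟩, χ, hχ,
    fun v hv => by simpa using hv.2⟩

variable (L M) in
/-- Łoś's theorem for an ultrapower of `M` over a nonprincipal ultrafilter on `ℕ`. -/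
theorem exists_ultrapower [Nonempty M] :
    ∃ (U : Type w) (_ : L.Structure U) (c : (ℕ → M) → U), Function.Surjective c ∧ (M ≅[L] U) ∧
      ∀ {β : Type} (φ : L.Formula β) (x : β → ℕ → M),
        φ.Realize (fun i => c (x i)) ↔
          ∀ᶠ k in (hyperfilter ℕ : Filter ℕ), φ.Realize fun i => x i k := by
  refine ⟨((hyperfilter ℕ : Ultrafilter ℕ) : Filter ℕ).Product fun _ => M, inferInstance,
    Quotient.mk _, Quotient.mk_surjective, ?_, fun φ x => Ultraproduct.realize_formula_cast φ x⟩
  rw [elementarilyEquivalent_iff]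
  intro φ
  rw [Ultraproduct.sentence_realize]
  simp

/-- **Omitting types**: a type that is not isolated over the complete theory of `M` is omitted in
some countable structure elementarily equivalent to `M`. -/
theorem exists_countable_omitting [Countable L.Symbols] [Nonempty M] {n : ℕ}
    {p : Set (L.Formula (Fin n))}
    (hp : ∀ ψ : L.Formula (Fin n), (∃ b : Fin n → M, ψ.Realize b) →
      ∃ b : Fin n → M, ψ.Realize b ∧ ∃ χ ∈ p, ¬ χ.Realize b) :
    ∃ (N : Type w) (_ : L.Structure N), Countable N ∧ (M ≅[L] N) ∧
      ∀ b : Fin n → N, ∃ χ ∈ p, ¬ χ.Realize b := by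
  -- A Henkin construction in forcing form: conditions are nonempty definable cylinders, with
  -- smaller ones larger in the order. The countable set `W` lists the requirements, either to
  -- decide a witness for a formula or to omit `p` at a tuple of coordinates.
  let P := {D : Set (ℕ → M) // IsDefinableCylinder L D ∧ D.Nonempty}ᵒᵈ
  let W := (Σ k, L.Formula (Fin (k + 1)) × (Fin k → ℕ)) ⊕ (Fin n → ℕ)
  let 𝒟 : W → Order.Cofinal P := Sum.elim
    (fun r =>
      { carrier := {D : P |
          (∃ j, ∀ v ∈ (OrderDual.ofDual D).1, r.2.1.Realize (Fin.snoc (v ∘ r.2.2) (v j) : _ → M)) ∨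
            ∀ v ∈ (OrderDual.ofDual D).1, ∀ a, ¬ r.2.1.Realize (Fin.snoc (v ∘ r.2.2) a : _ → M)}
        isCofinal := fun D => by
          obtain ⟨D', h, h₁, h₂, h₃⟩ := (OrderDual.ofDual D).2.1.exists_subset_witness
            (OrderDual.ofDual D).2.2 r.2.1 r.2.2
          exact ⟨OrderDual.toDual ⟨D', h₁, h₂⟩, h₃, h⟩ })
    (fun i =>
      { carrier := {D : P | ∃ χ ∈ p, ∀ v ∈ (OrderDual.ofDual D).1, ¬ χ.Realize (v ∘ i)}
        isCofinal := fun D => by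
          obtain ⟨D', h, h₁, h₂, h₃⟩ := (OrderDual.ofDual D).2.1.exists_subset_omitting
            (OrderDual.ofDual D).2.2 hp i
          exact ⟨OrderDual.toDual ⟨D', h₁, h₂⟩, h₃, h⟩ })
  let _ : Encodable W := Encodable.ofCountable W
  have huniv : IsDefinableCylinder L (Set.univ : Set (ℕ → M)) :=
    ⟨0, Set.univ, definable_univ, by simp⟩
  let C : ℕ → P := Order.sequenceOfCofinals
    (OrderDual.toDual ⟨Set.univ, huniv, univ_nonempty⟩ : P) 𝒟
  have hC : Monotone C := Order.sequenceOfCofinals.monotone _ _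
  have hmeet (r : W) : ∃ k, C k ∈ 𝒟 r := ⟨_, Order.sequenceOfCofinals.encode_mem _ 𝒟 r⟩
  -- The decreasing cylinders `C k` may have empty intersection in `M`; points `s k` of them define
  -- a sequence `t` in the ultrapower which, by Łoś, meets every requirement.
  choose s hs using fun k => (OrderDual.ofDual (C k)).2.2
  obtain ⟨U, _, c, hc, hMU, hreal⟩ := exists_ultrapower L M
  let t (j : ℕ) : U := c fun k => s k j
  have hev (k : ℕ) : ∀ᶠ l in (hyperfilter ℕ : Filter ℕ), s l ∈ (OrderDual.ofDual (C k)).1 :=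
    ((eventually_ge_atTop k).filter_mono Nat.hyperfilter_le_atTop).mono fun l hl => hC hl (hs l)
  have hsnoc {k : ℕ} (i : Fin k → ℕ) (a : ℕ → M) : (Fin.snoc (t ∘ i) (c a) : Fin (k + 1) → U) =
      fun l => c fun m => (Fin.snoc (s m ∘ i) (a m) : Fin (k + 1) → M) l := by
    ext l
    cases l using Fin.lastCases <;> simp [t]
  obtain ⟨N, hN⟩ := exists_elementarySubstructure_eq (L := L) (range t) (by
    intro k φ x hx a ha
    choose i hi using hx
    obtain rfl : t ∘ i = x := funext hi
    obtain ⟨a, rfl⟩ := hc a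
    obtain ⟨m, hm⟩ := hmeet (.inl ⟨k, φ, i⟩)
    rcases hm with ⟨j, hj⟩ | hm
    · refine ⟨t j, ⟨j, rfl⟩, ?_⟩
      rw [hsnoc i, hreal]
      exact (hev m).mono fun l hl => hj _ hl
    · exfalso
      rw [hsnoc i, hreal] at ha
      obtain ⟨l, hl, hl'⟩ := (ha.and (hev m)).exists
      exact hm _ hl' _ hl)
  refine ⟨N, inferInstance, ?_, ?_, fun b => ?_⟩
  · have : (N : Set U).Countable := hN ▸ countable_range t
    exact this.to_subtype
  · exact hMU.trans N.elementarilyEquivalent.symm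
  · have hb (l : Fin n) : ∃ j, t j = b l := by
      have : (b l : U) ∈ (N : Set U) := (b l).2
      rwa [hN] at this
    choose i hi using hb
    obtain ⟨m, χ, hχ, hm⟩ := hmeet (.inr i)
    refine ⟨χ, hχ, fun h => ?_⟩
    rw [← N.subtype.map_formula] at h
    have : N.subtype ∘ b = fun l => c fun m => s m (i l) :=
      funext fun l => (hi l).symm
    rw [this, hreal] at h
    obtain ⟨l, hl, hl'⟩ := (h.and (hev m)).exists
    exact hm _ hl' hl

/-- The direction of the Ryll-Nardzewski theorem that counts types. -/
theorem finite_range_types_of_categorical [Countable L.Symbols] [Infinite M]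
    (h : (aleph0.{w}).Categorical (L.completeTheory M)) (n : ℕ) :
    (range fun b : Fin n → M => {φ : L.Formula (Fin n) | φ.Realize b}).Finite := by
  by_contra hinf
  obtain ⟨e, he⟩ : ∃ a : ℕ → Fin n → M,
      Function.Injective fun k => {φ : L.Formula (Fin n) | φ.Realize (a k)} := by
    let f := Set.Infinite.natEmbedding _ hinf
    choose a ha using fun k => (f k).2
    refine ⟨a, fun k l hkl => f.injective (Subtype.ext ?_)⟩
    rw [← ha k, ← ha l]
    exact hkl
  -- The class `a` of a sequence of tuples with pairwise distinct types has a non-isolated type: a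
  -- formula isolating it would hold at infinitely many `e k`, forcing them all to have the type of
  -- `a`.
  obtain ⟨U, _, c, -, hMU, hreal⟩ := exists_ultrapower L M
  let a (i : Fin n) : U := c fun k => e k i
  obtain ⟨N, _, hNc, hMN, hN⟩ := exists_countable_omitting (M := M)
      (p := {φ : L.Formula (Fin n) | φ.Realize a}) (by
    rintro ψ ⟨b, hb⟩
    by_cases hψ : ψ.Realize a
    · rw [hreal] at hψ
      have hψinf : {k | ψ.Realize (e k)}.Infinite := fun hfin =>
        notMem_hyperfilter_of_finite hfin hψ
      obtain ⟨k, hk, l, hl, hkl⟩ := hψinf.nontrivial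
      by_contra! hcon
      refine hkl (he ?_)
      have key (m : ℕ) (hm : ψ.Realize (e m)) :
          {φ : L.Formula (Fin n) | φ.Realize (e m)} = {φ | φ.Realize a} := by
        ext χ
        refine ⟨fun hχ => ?_, hcon _ hm χ⟩
        by_contra hχa
        exact Formula.realize_not.1 (hcon _ hm χ.not (Formula.realize_not.2 hχa)) hχ
      exact (key k hk).trans (key l hl).symm
    · exact ⟨b, hb, ψ.not, Formula.realize_not.2 hψ, fun h => Formula.realize_not.1 h hb⟩)
  have : Infinite U := hMU.infinite
  have : Infinite N := hMN.infinite
  -- `S` is a countable model realizing the type of `a`, and `N` one omitting it, so they cannot be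
  -- isomorphic.
  obtain ⟨S, haS, hS⟩ := exists_elementarySubstructure_card_eq L (range a) aleph0.{w} le_rfl
    (by simp)
    (by
      rw [lift_aleph0, lift_le_aleph0]
      exact (mk_le_aleph0 : #L.Symbols ≤ ℵ₀)) (by simp)
  have : M ≅[L] S := hMU.trans S.elementarilyEquivalent.symm
  have hSm : S ⊨ L.completeTheory M := this.completeTheory_eq ▸ inferInstance
  have hNm : N ⊨ L.completeTheory M := hMN.completeTheory_eq ▸ inferInstance
  obtain ⟨f⟩ := h (Theory.ModelType.of _ S) (Theory.ModelType.of _ N) (by simpa using hS)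
    (mk_eq_aleph0 N)
  obtain ⟨χ, hχ, hχN⟩ := hN fun i => f ⟨a i, haS ⟨i, rfl⟩⟩
  refine hχN ?_
  have hfa := StrongHomClass.realize_formula f χ (v := fun i => ⟨a i, haS ⟨i, rfl⟩⟩)
  refine hfa.2 ?_
  exact (S.subtype.map_formula χ (fun i => ⟨a i, haS ⟨i, rfl⟩⟩)).1 hχ

end ModelTheory

/-! ### Finitely many marked `n`-generated subgroups, and local finiteness of `G`. -/

section UniformLocalFiniteness

open FirstOrder FirstOrder.Language

instance : Countable groupLanguage.Symbols := by
  have h (n : ℕ) : Countable (groupLanguage.Functions n) := by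
    refine Function.Injective.countable (β := ℕ)
      (f := fun x : GroupFunc n => match x with | .mul => 0 | .inv => 1 | .one => 2) ?_
    rintro (_ | _ | _) y <;> cases y <;> exact fun _ => rfl
  have h' (n : ℕ) : Countable (groupLanguage.Relations n) := inferInstanceAs (Countable Empty)
  unfold Language.Symbols
  infer_instance

theorem exists_term_realize_eq_lift (G : Type*) [Group G] {α : Type*} (w : FreeGroup α) :
    ∃ t : groupLanguage.Term α, ∀ a : α → G, t.realize a = FreeGroup.lift a w := by
  induction w using FreeGroup.induction_on with
  | C1 => exact ⟨Term.func (L := groupLanguage) GroupFunc.one ![], fun a => rfl⟩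
  | of x => exact ⟨Term.var x, fun a => (FreeGroup.lift_apply_of).symm⟩
  | inv_of x _ =>
    exact ⟨Term.func (L := groupLanguage) GroupFunc.inv ![Term.var x], fun a => by
      rw [map_inv, FreeGroup.lift_apply_of]
      rfl⟩
  | mul x y hx hy =>
    obtain ⟨s, hs⟩ := hx
    obtain ⟨t, ht⟩ := hy
    exact ⟨Term.func (L := groupLanguage) GroupFunc.mul ![s, t], fun a => by
      rw [map_mul, ← hs, ← ht]
      rfl⟩

theorem IsOmegaCategorical.finite_range_ker_lift {G : Type*} [Group G]
    (hG : IsOmegaCategorical G) (n : ℕ) :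
    (Set.range fun a : Fin n → G => (FreeGroup.lift a).ker).Finite := by
  cases finite_or_infinite G
  · exact Set.finite_range _
  choose t ht using exists_term_realize_eq_lift G (α := Fin n)
  -- `F` reads the kernel off the type: `w` is a relation exactly when the formula `w = 1` belongs
  -- to it.
  let F (p : Set (groupLanguage.Formula (Fin n))) : Set (FreeGroup (Fin n)) :=
    {w | (t w).equal (t 1) ∈ p}
  refine Set.Finite.of_finite_image (f := fun N => (N : Set (FreeGroup (Fin n))))
    (((finite_range_types_of_categorical hG n).image F).subset ?_) SetLike.coe_injective.injOn
  rintro _ ⟨_, ⟨a, rfl⟩, rfl⟩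
  refine ⟨_, ⟨a, rfl⟩, ?_⟩
  ext w
  simp [F, ht, MonoidHom.mem_ker]

/-- Finitely generated subgroups of an `ω`-categorical group are finite. -/
theorem IsOmegaCategorical.finite_range_lift {G : Type*} [Group G]
    (hG : IsOmegaCategorical G) {n : ℕ} (a : Fin n → G) : Finite (FreeGroup.lift a).range := by
  -- An element `x = w(a)` is determined by the kernel of the extended tuple `(a, x)`, which
  -- contains `w` times the inverse of the last generator. Only finitely many such kernels exist.
  refine Set.Finite.of_finite_image (s := ((FreeGroup.lift a).range : Set G))
    (f := fun x => (FreeGroup.lift (Fin.snoc a x : Fin (n + 1) → G)).ker)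
    ((hG.finite_range_ker_lift (n + 1)).subset ?_) ?_
  · rintro _ ⟨x, -, rfl⟩
    exact ⟨_, rfl⟩
  · rintro _ ⟨w, rfl⟩ y - hxy
    have hw (x : G) : FreeGroup.lift (Fin.snoc a x : Fin (n + 1) → G)
        (FreeGroup.map Fin.castSucc w * (FreeGroup.of (Fin.last n))⁻¹) =
          FreeGroup.lift a w * x⁻¹ := by
      rw [map_mul, map_inv, FreeGroup.lift_apply_of, Fin.snoc_last]
      congr 1
      rw [← MonoidHom.comp_apply]
      congr 1
      ext i
      simp
    have h₁ := MonoidHom.mem_ker.2 ((hw (FreeGroup.lift a w)).trans (mul_inv_cancel _))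
    have h₂ := (SetLike.ext_iff.1 hxy _).1 h₁
    rw [MonoidHom.mem_ker, hw] at h₂
    exact mul_inv_eq_one.1 h₂

end UniformLocalFiniteness

/-! ### Relations and commutator series in the closure of a homomorphic image. -/

section Closure

variable {G P : Type*} [Group G] [Group P] [TopologicalSpace P] [IsTopologicalGroup P]

theorem continuous_lift_apply {α : Type*} (w : FreeGroup α) :
    Continuous fun τ : α → P => FreeGroup.lift τ w := by
  induction w using FreeGroup.induction_on with
  | C1 => simpa using continuous_const
  | of x => simpa using continuous_apply x
  | inv_of x _ =>
    simp only [map_inv, FreeGroup.lift_apply_of]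
    fun_prop
  | mul x y hx hy =>
    simp only [map_mul]
    exact hx.mul hy

/-- If the `n`-generated subgroups of `G` fall into finitely many marked isomorphism types, then an
`n`-tuple in the closure of a homomorphic image of `G` satisfies all relations of some `n`-tuple
of `G`. -/
theorem exists_ker_lift_le_of_mem_closure [T2Space P] (Φ : G →* P) {n : ℕ}
    (hfin : (Set.range fun a : Fin n → G => (FreeGroup.lift a).ker).Finite) (σ : Fin n → P)
    (hσ : ∀ i, σ i ∈ Φ.range.topologicalClosure) :
    ∃ a : Fin n → G, (FreeGroup.lift a).ker ≤ (FreeGroup.lift σ).ker := by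
  have hσ' : σ ∈ closure (⋃ N ∈ Set.range fun a : Fin n → G => (FreeGroup.lift a).ker,
      {τ : Fin n → P | ∃ a : Fin n → G, (FreeGroup.lift a).ker = N ∧ Φ ∘ a = τ}) := by
    have h : σ ∈ closure (Set.univ.pi fun _ => (Φ.range : Set P)) := by
      rw [closure_pi_set]
      exact fun i _ => hσ i
    refine closure_mono ?_ h
    intro τ hτ
    choose a ha using fun i => hτ i trivial
    exact Set.mem_biUnion ⟨a, rfl⟩ ⟨a, rfl, funext ha⟩
  -- Closure commutes with this finite union over kernels, so `σ` is a limit of tuples sharing one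
  -- kernel.
  rw [hfin.closure_biUnion] at hσ'
  obtain ⟨_, ⟨a, rfl⟩, h⟩ := Set.mem_iUnion₂.1 hσ'
  refine ⟨a, fun w hw => ?_⟩
  refine closure_minimal (t := {τ : Fin n → P | FreeGroup.lift τ w = 1}) ?_
    (isClosed_eq (continuous_lift_apply w) continuous_const) h
  rintro _ ⟨b, hb, rfl⟩
  have : FreeGroup.lift (Φ ∘ b) = Φ.comp (FreeGroup.lift b) := by
    ext i
    simp
  simp only [Set.mem_ofPred_eq, this, MonoidHom.comp_apply]
  have hw' : w ∈ (FreeGroup.lift b).ker := hb ▸ hw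
  rw [MonoidHom.mem_ker.1 hw', map_one]

theorem commutator_topologicalClosure_le (A B : Subgroup P) :
    ⁅A.topologicalClosure, B.topologicalClosure⁆ ≤ ⁅A, B⁆.topologicalClosure := by
  rw [Subgroup.commutator_le]
  intro a ha b hb
  exact map_mem_closure₂ (f := fun x y : P => x * y * x⁻¹ * y⁻¹) (by fun_prop) ha hb
    fun x hx y hy => Subgroup.commutator_mem_commutator hx hy

variable (Φ : G →* P)

theorem map_subtype_derivedSeries_le (n : ℕ) :
    (derivedSeries Φ.range.topologicalClosure n).map Φ.range.topologicalClosure.subtype ≤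
      ((derivedSeries G n).map Φ).topologicalClosure := by
  induction n with
  | zero => simp [← MonoidHom.range_eq_map]
  | succ n ih =>
    rw [derivedSeries_succ, derivedSeries_succ, Subgroup.map_commutator, Subgroup.map_commutator]
    exact (Subgroup.commutator_mono ih ih).trans (commutator_topologicalClosure_le _ _)

theorem map_subtype_lowerCentralSeries_le (n : ℕ) :
    ((⊤ : Subgroup Φ.range.topologicalClosure).lowerCentralSeries n).map
        Φ.range.topologicalClosure.subtype ≤
      (((⊤ : Subgroup G).lowerCentralSeries n).map Φ).topologicalClosure := by
  induction n with
  | zero => simp [← MonoidHom.range_eq_map]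
  | succ n ih =>
    rw [Subgroup.lowerCentralSeries_succ, Subgroup.lowerCentralSeries_succ,
      Subgroup.map_commutator, Subgroup.map_commutator]
    refine (Subgroup.commutator_mono ih ?_).trans (commutator_topologicalClosure_le _ _)
    simp [← MonoidHom.range_eq_map]

theorem topologicalClosure_bot [T1Space P] : (⊥ : Subgroup P).topologicalClosure = ⊥ := by
  ext x
  simp [← SetLike.mem_coe]

variable {Φ}

/-- A homomorphism into a topological group, with values in the closure of its range. -/
def toClosure (Φ : G →* P) : G →* Φ.range.topologicalClosure :=
  Φ.codRestrict _ fun g => Φ.range.le_topologicalClosure ⟨g, rfl⟩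

theorem toClosure_injective (hΦ : Function.Injective Φ) : Function.Injective (toClosure Φ) :=
  fun _ _ h => hΦ (congrArg Subtype.val h)

/-- Forwards, `G` embeds in the closure. Backwards, the series of the closure lies in the closure of
the image of that of `G`, and the trivial subgroup is closed. -/
theorem derivedSeries_closure_eq_bot_iff [T1Space P] (hΦ : Function.Injective Φ) (n : ℕ) :
    derivedSeries Φ.range.topologicalClosure n = ⊥ ↔ derivedSeries G n = ⊥ := by
  constructor <;> intro h
  · have := map_derivedSeries_le_derivedSeries (toClosure Φ) n
    rwa [h, le_bot_iff, Subgroup.map_eq_bot_iff_of_injective _ (toClosure_injective hΦ)] at this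
  · have := map_subtype_derivedSeries_le Φ n
    rwa [h, Subgroup.map_bot, topologicalClosure_bot, le_bot_iff,
      Subgroup.map_eq_bot_iff_of_injective _ (Subgroup.subtype_injective _)] at this

theorem lowerCentralSeries_closure_eq_bot_iff [T1Space P] (hΦ : Function.Injective Φ) (n : ℕ) :
    (⊤ : Subgroup Φ.range.topologicalClosure).lowerCentralSeries n = ⊥ ↔
      (⊤ : Subgroup G).lowerCentralSeries n = ⊥ := by
  constructor <;> intro h
  · have : _ ≤ (⊤ : Subgroup Φ.range.topologicalClosure).lowerCentralSeries n :=
      (Subgroup.map_lowerCentralSeries (⊤ : Subgroup G) (toClosure Φ) n).trans_le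
        (Subgroup.lowerCentralSeries_mono n le_top)
    rwa [h, le_bot_iff, Subgroup.map_eq_bot_iff_of_injective _ (toClosure_injective hΦ)] at this
  · have := map_subtype_lowerCentralSeries_le Φ n
    rwa [h, Subgroup.map_bot, topologicalClosure_bot, le_bot_iff,
      Subgroup.map_eq_bot_iff_of_injective _ (Subgroup.subtype_injective _)] at this

end Closure

/-! ### Faithfulness of the coset action and the main theorem. -/

instance permT2Space (X : Type*) : T2Space (Equiv.Perm X) := by
  let _ : TopologicalSpace X := ⊥
  have : DiscreteTopology X := ⟨rfl⟩
  exact T2Space.of_injective_continuous (f := fun σ : Equiv.Perm X => (σ : X → X))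
    DFunLike.coe_injective continuous_induced_dom

theorem mem_of_smul_coset_eq {G : Type*} [Group G] {K : Subgroup G} {g : G}
    (h : g • (K : Set G) = K) : g ∈ K := by
  have : g • (1 : G) ∈ g • (K : Set G) := Set.smul_mem_smul_set K.one_mem
  rw [h] at this
  simpa using this

/-- An element acting trivially fixes the coset `K` itself, hence lies in every `K` commensurable
with `H`. These include `H` and its finite-index normal subgroups, whose intersection is trivial. -/
theorem toPermHom_cosetSpace_injective {G : Type*} [Group G] (H : Subgroup G)
    [Group.ResiduallyFinite H] :
    Function.Injective (MulAction.toPermHom G (cosetSpace H)) := by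
  rw [injective_iff_map_eq_one]
  intro g hg
  have hmem (K : Subgroup G) (hK : K.Commensurable H) : g ∈ K := by
    let x : cosetSpace H := ⟨(K : Set G), K, hK, 1, (one_smul _ _).symm⟩
    have : g • x = x := DFunLike.congr_fun hg x
    exact mem_of_smul_coset_eq (congrArg Subtype.val this)
  have hgH : g ∈ H := hmem H (Subgroup.Commensurable.refl H)
  have : (⟨g, hgH⟩ : H) = 1 := by
    refine Group.eq_one_iff_forall_finiteIndexNormalSubroup _ fun N => ?_
    have hN : (N.toSubgroup.map H.subtype).Commensurable H := by
      have hle : N.toSubgroup.map H.subtype ≤ H := Subgroup.map_subtype_le _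
      refine ⟨?_, ?_⟩
      · rw [Subgroup.relIndex, Subgroup.subgroupOf, Subgroup.comap_map_eq_self_of_injective
          (Subgroup.subtype_injective H)]
        exact Subgroup.FiniteIndex.index_ne_zero
      · rw [Subgroup.relIndex_eq_one.2 hle]
        exact one_ne_zero
    obtain ⟨x, hx, hxg⟩ := hmem _ hN
    obtain rfl : x = ⟨g, hgH⟩ := Subtype.ext hxg
    exact hx
  exact congrArg Subtype.val this

theorem exists_finite_surjective_of_fg {G : Type*} [Group G] (hG : IsOmegaCategorical G)
    (H : Subgroup G) (K : Subgroup (completion H)) (hK : K.FG) :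
    ∃ F : Subgroup G, Finite F ∧ ∃ f : F →* K, Function.Surjective f := by
  obtain ⟨S, rfl⟩ := hK
  let σ (i : Fin S.card) : completion H := S.equivFin.symm i
  obtain ⟨a, ha⟩ := exists_ker_lift_le_of_mem_closure (MulAction.toPermHom G (cosetSpace H))
    (hG.finite_range_ker_lift S.card) (fun i => (σ i : Equiv.Perm (cosetSpace H)))
    fun i => (σ i).2
  have hrange : (FreeGroup.lift σ).range = Subgroup.closure (S : Set (completion H)) := by
    rw [FreeGroup.range_lift_eq_closure]
    congr 1
    ext x
    constructor
    · rintro ⟨i, rfl⟩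
      exact (S.equivFin.symm i).2
    · exact fun hx => ⟨S.equivFin ⟨x, hx⟩, by simp [σ]⟩
  -- This inclusion makes the free group's map onto `⟨σ⟩` factor through the finite group `⟨a⟩`.
  have hker : (FreeGroup.lift a).rangeRestrict.ker ≤ (FreeGroup.lift σ).rangeRestrict.ker := by
    rw [MonoidHom.ker_rangeRestrict, MonoidHom.ker_rangeRestrict]
    refine ha.trans fun w hw => ?_
    have : FreeGroup.lift (fun i => (σ i : Equiv.Perm (cosetSpace H))) =
        (completion H).subtype.comp (FreeGroup.lift σ) := by
      ext i : 1
      simp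
    rw [this, MonoidHom.mem_ker] at hw
    exact MonoidHom.mem_ker.2 (Subtype.ext hw)
  rw [← hrange]
  refine ⟨(FreeGroup.lift a).range, hG.finite_range_lift a,
    (FreeGroup.lift a).rangeRestrict.liftOfSurjective (FreeGroup.lift a).rangeRestrict_surjective
      ⟨_, hker⟩, ?_⟩
  intro y
  obtain ⟨w, rfl⟩ := (FreeGroup.lift σ).rangeRestrict_surjective y
  exact ⟨_, MonoidHom.liftOfRightInverse_comp_apply _ _ _ ⟨_, hker⟩ w⟩

end OmegaCatGroup

theorem mainTheorem9 {G : Type*} [Group G] (hG : OmegaCatGroup.IsOmegaCategorical G)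
    (H : Subgroup G) (hH : OmegaCatGroup.IsInert H) [Group.ResiduallyFinite H] :
    (∀ K : Subgroup (OmegaCatGroup.completion H), K.FG →
      ∃ F : Subgroup G, Finite F ∧ ∃ f : F →* K, Function.Surjective f) ∧
    (∀ K : Subgroup (OmegaCatGroup.completion H), K.FG → Finite K) ∧
    (∀ k : ℕ, OmegaCatGroup.HasNilpotencyClass G k →
      OmegaCatGroup.HasNilpotencyClass (OmegaCatGroup.completion H) k) ∧
    (∀ k : ℕ, OmegaCatGroup.HasDerivedLength G k →
      OmegaCatGroup.HasDerivedLength (OmegaCatGroup.completion H) k) := by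
  have hinj := OmegaCatGroup.toPermHom_cosetSpace_injective H
  have hfg := OmegaCatGroup.exists_finite_surjective_of_fg hG H
  refine ⟨hfg, fun K hK => ?_, ?_, ?_⟩
  · obtain ⟨F, _, f, hf⟩ := hfg K hK
    exact Finite.of_surjective f hf
  · rintro k ⟨hnil, rfl⟩
    have hbot := OmegaCatGroup.lowerCentralSeries_closure_eq_bot_iff hinj
    have : Group.IsNilpotent (OmegaCatGroup.completion H) :=
      Subgroup.nilpotent_iff_lowerCentralSeries.2 ⟨_, (hbot _).2
        (Subgroup.lowerCentralSeries_eq_bot_iff_nilpotencyClass_le.2 le_rfl)⟩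
    -- The class is recovered from the set of `n` at which the lower central series vanishes, and
    -- this set is the same for `G` and its completion.
    refine ⟨this, eq_of_forall_ge_iff fun n => ?_⟩
    rw [← Subgroup.lowerCentralSeries_eq_bot_iff_nilpotencyClass_le,
      ← Subgroup.lowerCentralSeries_eq_bot_iff_nilpotencyClass_le]
    exact hbot n
  · intro k hk
    have hbot := OmegaCatGroup.derivedSeries_closure_eq_bot_iff hinj
    unfold OmegaCatGroup.HasDerivedLength at hk ⊢
    unfold OmegaCatGroup.completion
    simpa only [hbot] using hk
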